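/- Let $A$ be a ring with unit, $\mathfrak C$ an $A$-coring, and $\Sigma$ a right $\mathfrak C$-comodule with coaction $u\mapsto u_{[0]}\otimes_A u_{[1]}$; write $\Sigma^*=\mathrm{Hom}_A(\Sigma,A)$ and let $T=\mathrm{End}^{\mathfrak C}(\Sigma)$ be the ring of right $\mathfrak C$-colinear endomorphisms of $\Sigma$. Rings other than $A$ need not have a unit. A ring $R$ is called firm if the multiplication map $R\otimes_R R\to R$ is bijective, and a left $R$-module $X$ is called firm if $R\otimes_R X\to X$, $r\otimes x\mapsto rx$, is bijective. An $R$-$\mathfrak C$-bicomodule is a right $\mathfrak C$-comodule $X$ with a left $R$-module structure given by a ring morphism $R\to\mathrm{End}^{\mathfrak C}(X)$. * An $R$-$\mathfrak C$-bicomodule $\Sigma$ is an $R$-$\mathfrak C$ Galois comodule if $\Sigma$ is a firm left $R$-module, its $R$-action is induced by some ring morphism $\iota:R\to\Sigma\otimes_A\Sigma^*$ (where $\Sigma\otimes_A\Sigma^*$ has the product $(u\otimes f)(v\otimes g)=uf(v)\otimes g$ and acts on $\Sigma$ by $(u\otimes f)x=uf(x)$), and the map $\mathsf{can}:\Sigma^*\otimes_R\Sigma\to\mathfrak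 C$, $f\otimes u\mapsto f(u_{[0]})u_{[1]}$, is an isomorphism. * An $R$-$\mathfrak C$-bicomodule $X$ is an $R$-$\mathfrak C$ comonadic-Galois comodule if $X$ is a firm left $R$-module and $\mathsf{can}_M:\mathrm{Hom}_A(X,M)\otimes_R X\to M\otimes_A\mathfrak C$, $f\otimes x\mapsto f(x_{[0]})\otimes x_{[1]}$, is an isomorphism for every right $A$-module $M$. **Proposition.** Let $R$ be a firm ring and let $\Sigma$ be an $R$-$\mathfrak C$ Galois comodule. Let $S$ be any firm ring with $R\subset S\subset T$ or, more generally, with ring morphisms $R\to S\to T$ whose composite is the given morphism $R\to T$. Equip $S\otimes_S\Sigma$ with the left $S$-action $t(s\otimes u)=ts\otimes u$, the right $A$-action $(s\otimes u)a=s\otimes ua$ and the coaction $s\otimes u\mapsto(s\otimes u_{[0]})\otimes_A u_{[1]}$. Then $S\otimes_S\Sigma$ is an $S$-$\mathfrak C$ comonadic-Galois comodule. -/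

import Mathlib

open scoped TensorProduct
open MulOpposite (op)

/-! ### Balanced tensor products

All rings below may be noncommutative, and the rings `R`, `S` may lack a unit. Right modules over a
unital ring `A` are `Aᵐᵒᵖ`-modules, so that `op a • m` stands for `m a`. -/

section BalTensor

variable {R N M P : Type*} [AddCommGroup N] [AddCommGroup M] [AddCommGroup P]

/-- The tensor product of abelian groups `N`, `M` balanced over `R`, where `α` is the right action
of `R` on `N` and `β` is the left action of `R` on `M`: the quotient of `N ⊗ M` (over `ℤ`) by the
relations `n r ⊗ m = n ⊗ r m`. -/
def BalTensor (α : R → N →+ N) (β : R → M →+ M) : Type _ :=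
  (N ⊗[ℤ] M) ⧸ AddSubgroup.closure
    {x : N ⊗[ℤ] M | ∃ (r : R) (n : N) (m : M), x = (α r n) ⊗ₜ[ℤ] m - n ⊗ₜ[ℤ] (β r m)}

namespace BalTensor

variable {α : R → N →+ N} {β : R → M →+ M}

instance : AddCommGroup (BalTensor α β) :=
  inferInstanceAs (AddCommGroup ((N ⊗[ℤ] M) ⧸ AddSubgroup.closure
    {x : N ⊗[ℤ] M | ∃ (r : R) (n : N) (m : M), x = (α r n) ⊗ₜ[ℤ] m - n ⊗ₜ[ℤ] (β r m)}))

variable (α β) in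
/-- The pure tensor `n ⊗ m`, as a biadditive map. -/
def tmul : N →+ M →+ BalTensor α β :=
  AddMonoidHom.mk' (fun n => AddMonoidHom.mk'
    (fun m => (QuotientAddGroup.mk (n ⊗ₜ[ℤ] m) : BalTensor α β))
    (fun m m' => by rw [TensorProduct.tmul_add]; rfl))
    (fun n n' => by ext m; exact congrArg _ (TensorProduct.add_tmul n n' m))

theorem tmul_balanced (r : R) (n : N) (m : M) :
    tmul α β (α r n) m = tmul α β n (β r m) := by
  refine (QuotientAddGroup.eq).2 ?_
  rw [← neg_mem_iff, neg_add_rev, neg_neg, neg_add_eq_sub]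
  have h : α r n ⊗ₜ[ℤ] m - n ⊗ₜ[ℤ] β r m ∈ AddSubgroup.closure
    {x : N ⊗[ℤ] M | ∃ (r : R) (n : N) (m : M), x = (α r n) ⊗ₜ[ℤ] m - n ⊗ₜ[ℤ] (β r m)} :=
    AddSubgroup.subset_closure ⟨r, n, m, rfl⟩
  rw [← neg_mem_iff, neg_sub] at h
  rw [← neg_mem_iff, neg_sub]
  exact h

/-- A biadditive balanced map factors through the balanced tensor product. -/
def lift (f : N →+ M →+ P) (hf : ∀ r n m, f (α r n) m = f n (β r m)) : BalTensor α β →+ P :=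
  QuotientAddGroup.lift _
    (TensorProduct.liftAddHom f (fun z n m => by simp))
    (by
      rw [AddSubgroup.closure_le]
      rintro _ ⟨r, n, m, rfl⟩
      simp [hf])

@[simp]
theorem lift_tmul (f : N →+ M →+ P) (hf : ∀ r n m, f (α r n) m = f n (β r m)) (n : N) (m : M) :
    lift f hf (tmul α β n m) = f n m := rfl

theorem induction {p : BalTensor α β → Prop} (x : BalTensor α β)
    (tmul : ∀ n m, p (tmul α β n m)) (add : ∀ x y, p x → p y → p (x + y)) : p x := by
  obtain ⟨t, rfl⟩ := QuotientAddGroup.mk_surjective x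
  induction t with
  | zero =>
    have h := tmul 0 0
    rw [map_zero] at h
    exact h
  | tmul n m => exact tmul n m
  | add a b ha hb => exact add _ _ ha hb

theorem hom_ext {f g : BalTensor α β →+ P} (h : ∀ n m, f (tmul α β n m) = g (tmul α β n m)) :
    f = g := by
  ext x
  induction x using induction with
  | tmul n m => exact h n m
  | add x y hx hy => rw [map_add, map_add, hx, hy]

/-- The map `n ⊗ m ↦ n ⊗ g m`, for `g` commuting with the action of `R`. -/
def mapRight (g : M →+ M) (hg : ∀ r m, β r (g m) = g (β r m)) : BalTensor α β →+ BalTensor α β :=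
  lift ((tmul α β).compl₂ g) (fun r n m => by
    change tmul α β (α r n) (g m) = tmul α β n (g (β r m))
    rw [tmul_balanced, hg])

/-- The map `n ⊗ m ↦ f n ⊗ m`, for `f` commuting with the action of `R`. -/
def mapLeft (f : N →+ N) (hf : ∀ r n, α r (f n) = f (α r n)) : BalTensor α β →+ BalTensor α β :=
  lift ((tmul α β).comp f) (fun r n m => by
    change tmul α β (f (α r n)) m = tmul α β (f n) (β r m)
    rw [← tmul_balanced, hf])

/-- The action of `B` on a balanced tensor product through its right-hand factor. -/
abbrev moduleOfRight {B : Type*} [Semiring B] [Module B M]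
    (h : ∀ r (b : B) (m : M), β r (b • m) = b • β r m) : Module B (BalTensor α β) where
  smul b x := mapRight (DistribSMul.toAddMonoidHom M b) (fun r m => h r b m) x
  one_smul x := by
    change mapRight _ _ x = x
    induction x using induction with
    | tmul n m => exact congrArg (tmul α β n) (one_smul B m)
    | add x y hx hy => rw [map_add, hx, hy]
  mul_smul b c x := by
    change mapRight _ _ x = mapRight _ _ (mapRight _ _ x)
    induction x using induction with
    | tmul n m => exact congrArg (tmul α β n) (mul_smul b c m)
    | add x y hx hy => rw [map_add, hx, hy, map_add, map_add]
  smul_zero b := map_zero (mapRight _ _)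
  smul_add b := map_add (mapRight _ _)
  add_smul b c x := by
    change mapRight _ _ x = mapRight _ _ x + mapRight _ _ x
    induction x using induction with
    | tmul n m => exact (congrArg (tmul α β n) (add_smul b c m)).trans (map_add _ _ _)
    | add x y hx hy => rw [map_add, hx, hy, map_add, map_add, add_add_add_comm]
  zero_smul x := by
    change mapRight _ _ x = 0
    induction x using induction with
    | tmul n m => exact (congrArg (tmul α β n) (zero_smul B m)).trans (map_zero _)
    | add x y hx hy => rw [map_add, hx, hy, add_zero]

/-- The action of `B` on a balanced tensor product through its left-hand factor. -/
abbrev moduleOfLeft {B : Type*} [Semiring B] [Module B N]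
    (h : ∀ r (b : B) (n : N), α r (b • n) = b • α r n) : Module B (BalTensor α β) where
  smul b x := mapLeft (DistribSMul.toAddMonoidHom N b) (fun r n => h r b n) x
  one_smul x := by
    change mapLeft _ _ x = x
    induction x using induction with
    | tmul n m => exact congrArg (tmul α β · m) (one_smul B n)
    | add x y hx hy => rw [map_add, hx, hy]
  mul_smul b c x := by
    change mapLeft _ _ x = mapLeft _ _ (mapLeft _ _ x)
    induction x using induction with
    | tmul n m => exact congrArg (tmul α β · m) (mul_smul b c n)
    | add x y hx hy => rw [map_add, hx, hy, map_add, map_add]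
  smul_zero b := map_zero (mapLeft _ _)
  smul_add b := map_add (mapLeft _ _)
  add_smul b c x := by
    change mapLeft _ _ x = mapLeft _ _ x + mapLeft _ _ x
    induction x using induction with
    | tmul n m =>
      exact (congrArg (tmul α β · m) (add_smul b c n)).trans
        (DFunLike.congr_fun (map_add (tmul α β) _ _) m)
    | add x y hx hy => rw [map_add, hx, hy, map_add, map_add, add_add_add_comm]
  zero_smul x := by
    change mapLeft _ _ x = 0
    induction x using induction with
    | tmul n m =>
      exact (congrArg (tmul α β · m) (zero_smul B n)).trans
        (DFunLike.congr_fun (map_zero (tmul α β)) m)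
    | add x y hx hy => rw [map_add, hx, hy, add_zero]

end BalTensor

end BalTensor

/-! ### Tensor products over a unital ring -/

section TensorOver

variable (A : Type*) [Ring A]

/-- The right action of `A` on a right `A`-module. -/
abbrev rightAct (N : Type*) [AddCommGroup N] [Module Aᵐᵒᵖ N] (a : A) : N →+ N :=
  DistribSMul.toAddMonoidHom N (op a)

/-- The left action of `A` on a left `A`-module. -/
abbrev leftAct (M : Type*) [AddCommGroup M] [Module A M] (a : A) : M →+ M :=
  DistribSMul.toAddMonoidHom M a

/-- `N ⊗_A M` for a right `A`-module `N` and a left `A`-module `M`. -/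
abbrev TensorOver (N M : Type*) [AddCommGroup N] [Module Aᵐᵒᵖ N] [AddCommGroup M] [Module A M] :
    Type _ :=
  BalTensor (rightAct A N) (leftAct A M)

variable {A} {N N' N'' M M' D : Type*} [AddCommGroup N] [Module Aᵐᵒᵖ N]
  [AddCommGroup N'] [Module Aᵐᵒᵖ N'] [AddCommGroup N''] [Module Aᵐᵒᵖ N'']
  [AddCommGroup M] [Module A M] [AddCommGroup M'] [Module A M'] [AddCommGroup D] [Module A D]

/-- `(n ⊗ m) a = n ⊗ (m a)` when `M` is an `A`-bimodule. -/
instance [Module Aᵐᵒᵖ M] [SMulCommClass A Aᵐᵒᵖ M] :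
    Module Aᵐᵒᵖ (BalTensor (rightAct A N) (leftAct A M)) :=
  BalTensor.moduleOfRight (fun a b m => smul_comm a b m)

/-- `a (n ⊗ m) = (a n) ⊗ m` when `N` is an `A`-bimodule. -/
instance [Module A N] [SMulCommClass A Aᵐᵒᵖ N] :
    Module A (BalTensor (rightAct A N) (leftAct A M)) :=
  BalTensor.moduleOfLeft (fun a b n => (smul_comm b (op a) n).symm)

namespace TensorOver

variable (A) in
/-- The pure tensor `n ⊗_A m`. -/
abbrev mk : N →+ M →+ TensorOver A N M := BalTensor.tmul (rightAct A N) (leftAct A M)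

variable (M) in
/-- The map `f ⊗_A M`. -/
def rT (f : N →ₗ[Aᵐᵒᵖ] N') : TensorOver A N M →+ TensorOver A N' M :=
  BalTensor.lift ((mk A).comp f.toAddMonoidHom) (fun a n m => by
    change mk A (f (op a • n)) m = mk A (f n) (a • m)
    rw [map_smul f]
    exact BalTensor.tmul_balanced (α := rightAct A N') (β := leftAct A M) a (f n) m)

variable (N) in
/-- The map `N ⊗_A g`. -/
def lT (g : M →ₗ[A] M') : TensorOver A N M →+ TensorOver A N M' :=
  BalTensor.lift ((mk A).compl₂ g.toAddMonoidHom) (fun a n m => by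
    change mk A (op a • n) (g m) = mk A n (g (a • m))
    rw [map_smul g]
    exact BalTensor.tmul_balanced (α := rightAct A N) (β := leftAct A M') a n (g m))

@[simp]
theorem rT_mk (f : N →ₗ[Aᵐᵒᵖ] N') (n : N) (m : M) : rT M f (mk A n m) = mk A (f n) m := rfl

@[simp]
theorem lT_mk (g : M →ₗ[A] M') (n : N) (m : M) : lT N g (mk A n m) = mk A n (g m) := rfl

theorem smul_mk [Module A N] [SMulCommClass A Aᵐᵒᵖ N] (a : A) (n : N) (m : M) :
    a • mk A n m = mk A (a • n) m := rfl

theorem op_smul_mk [Module Aᵐᵒᵖ M] [SMulCommClass A Aᵐᵒᵖ M] (a : Aᵐᵒᵖ) (n : N) (m : M) :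
    a • mk A n m = mk A n (a • m) := rfl

/-- The canonical map `A ⊗_A M → M`, `a ⊗ m ↦ a m`. -/
def lUnit : TensorOver A A M →+ M :=
  BalTensor.lift (smulAddHom A M) (fun a b m => by
    change (b * a) • m = b • a • m
    rw [mul_smul])

/-- The canonical map `N ⊗_A A → N`, `n ⊗ a ↦ n a`. -/
def rUnit : TensorOver A N A →+ N :=
  BalTensor.lift
    (AddMonoidHom.mk' (fun n => AddMonoidHom.mk' (fun a : A => op a • n)
      (fun a b => by rw [MulOpposite.op_add, add_smul]))
      (fun n n' => by ext a; exact smul_add (op a) n n'))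
    (fun a n b => by
      change op b • op a • n = op (a * b) • n
      rw [MulOpposite.op_mul, mul_smul])

/-- The map `m ⊗ d ↦ (n ⊗ m) ⊗ d ↦ n ⊗ (m ⊗ d)`, curried. -/
def assocAux [Module Aᵐᵒᵖ M] [SMulCommClass A Aᵐᵒᵖ M] :
    TensorOver A N M →+ D →+ TensorOver A N (TensorOver A M D) :=
  BalTensor.lift (P := D →+ TensorOver A N (TensorOver A M D))
    (AddMonoidHom.mk' (fun n => AddMonoidHom.mk' (fun m => (mk A n).comp (mk A m))
        (fun m m' => by
          ext d
          change mk A n (mk A (m + m') d) = mk A n (mk A m d) + mk A n (mk A m' d)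
          rw [map_add (mk A), AddMonoidHom.add_apply, map_add]))
      (fun n n' => by
        ext m d
        change mk A (n + n') (mk A m d) = mk A n (mk A m d) + mk A n' (mk A m d)
        rw [map_add (mk A), AddMonoidHom.add_apply]))
    (fun a n m => by
      ext d
      exact BalTensor.tmul_balanced (α := rightAct A N) (β := leftAct A (TensorOver A M D))
        a n (mk A m d))

/-- The associativity map `(N ⊗_A M) ⊗_A D → N ⊗_A (M ⊗_A D)`. -/
def assoc [Module Aᵐᵒᵖ M] [SMulCommClass A Aᵐᵒᵖ M] :
    TensorOver A (TensorOver A N M) D →+ TensorOver A N (TensorOver A M D) :=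
  BalTensor.lift assocAux
    (fun a x d => by
      induction x using BalTensor.induction with
      | tmul n m =>
        exact congrArg (mk A n)
          (BalTensor.tmul_balanced (α := rightAct A M) (β := leftAct A D) a m d)
      | add x y hx hy =>
        rw [map_add, map_add, map_add, AddMonoidHom.add_apply, AddMonoidHom.add_apply, hx, hy])

@[simp]
theorem assoc_mk [Module Aᵐᵒᵖ M] [SMulCommClass A Aᵐᵒᵖ M] (n : N) (m : M) (d : D) :
    assoc (mk A (mk A n m) d) = mk A n (mk A m d) := rfl

theorem rT_id (x : TensorOver A N M) : rT M (LinearMap.id : N →ₗ[Aᵐᵒᵖ] N) x = x := by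
  refine DFunLike.congr_fun (g := AddMonoidHom.id _) (BalTensor.hom_ext fun n m => ?_) x
  rfl

theorem rT_comp (g : N' →ₗ[Aᵐᵒᵖ] N'') (f : N →ₗ[Aᵐᵒᵖ] N') (x : TensorOver A N M) :
    rT M (g ∘ₗ f) x = rT M g (rT M f x) := by
  refine DFunLike.congr_fun (g := (rT M g).comp (rT M f)) (BalTensor.hom_ext fun n m => ?_) x
  rfl

theorem rT_add (f g : N →ₗ[Aᵐᵒᵖ] N') (x : TensorOver A N M) :
    rT M (f + g) x = rT M f x + rT M g x := by
  refine DFunLike.congr_fun (g := rT M f + rT M g) (BalTensor.hom_ext fun n m => ?_) x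
  change mk A (f n + g n) m = mk A (f n) m + mk A (g n) m
  rw [map_add, AddMonoidHom.add_apply]

theorem rT_op_smul [Module Aᵐᵒᵖ M] [SMulCommClass A Aᵐᵒᵖ M] (f : N →ₗ[Aᵐᵒᵖ] N')
    (a : Aᵐᵒᵖ) (x : TensorOver A N M) : rT M f (a • x) = a • rT M f x := by
  induction x using BalTensor.induction with
  | tmul n m => rfl
  | add x y hx hy => rw [smul_add, map_add, hx, hy, map_add, smul_add]

end TensorOver

end TensorOver

/-! ### Corings and comodules -/

/-- A homomorphism of `A`-bimodules. -/
structure BimodHom (A C D : Type*) [Ring A] [AddCommGroup C] [Module A C] [Module Aᵐᵒᵖ C]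
    [AddCommGroup D] [Module A D] [Module Aᵐᵒᵖ D] where
  /-- The map, as a homomorphism of left `A`-modules. -/
  left : C →ₗ[A] D
  map_op_smul : ∀ (a : Aᵐᵒᵖ) (c : C), left (a • c) = a • left c

/-- The underlying homomorphism of right `A`-modules. -/
def BimodHom.right {A C D : Type*} [Ring A] [AddCommGroup C] [Module A C] [Module Aᵐᵒᵖ C]
    [AddCommGroup D] [Module A D] [Module Aᵐᵒᵖ D] (f : BimodHom A C D) : C →ₗ[Aᵐᵒᵖ] D where
  toFun := f.left
  map_add' := map_add f.left
  map_smul' := f.map_op_smul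

/-- An `A`-coring structure on the `A`-bimodule `C`. -/
class Coring (A C : Type*) [Ring A] [AddCommGroup C] [Module A C] [Module Aᵐᵒᵖ C]
    [SMulCommClass A Aᵐᵒᵖ C] where
  /-- The comultiplication. -/
  comul : BimodHom A C (TensorOver A C C)
  /-- The counit. -/
  counit : BimodHom A C A
  coassoc : ∀ c : C, TensorOver.assoc (TensorOver.rT C comul.right (comul.left c)) =
    TensorOver.lT C comul.left (comul.left c)
  counit_left : ∀ c : C, TensorOver.lUnit (TensorOver.rT C counit.right (comul.left c)) = c
  counit_right : ∀ c : C, TensorOver.rUnit (TensorOver.lT C counit.left (comul.left c)) = c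

/-- A right `C`-comodule structure on the right `A`-module `M`. -/
class RightComodule (A C M : Type*) [Ring A] [AddCommGroup C] [Module A C] [Module Aᵐᵒᵖ C]
    [SMulCommClass A Aᵐᵒᵖ C] [Coring A C] [AddCommGroup M] [Module Aᵐᵒᵖ M] where
  /-- The coaction `m ↦ m₀ ⊗ m₁`. -/
  coact : M →ₗ[Aᵐᵒᵖ] TensorOver A M C
  coassoc : ∀ m : M, TensorOver.assoc (TensorOver.rT C coact (coact m)) =
    TensorOver.lT M (Coring.comul (A := A) (C := C)).left (coact m)
  counit : ∀ m : M,
    TensorOver.rUnit (TensorOver.lT M (Coring.counit (A := A) (C := C)).left (coact m)) = m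

section Comodule

variable (A C : Type*) [Ring A] [AddCommGroup C] [Module A C] [Module Aᵐᵒᵖ C]
  [SMulCommClass A Aᵐᵒᵖ C] [Coring A C]

/-- The coaction of a right comodule. -/
abbrev coact (M : Type*) [AddCommGroup M] [Module Aᵐᵒᵖ M] [RightComodule A C M] :
    M →ₗ[Aᵐᵒᵖ] TensorOver A M C :=
  RightComodule.coact

variable (X : Type*) [AddCommGroup X] [Module Aᵐᵒᵖ X] [RightComodule A C X]

/-- The ring `End^C(X)` of right `C`-colinear endomorphisms of the comodule `X`, with composition
as multiplication. -/
def ComodEnd : Subring (Module.End Aᵐᵒᵖ X) where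
  carrier := {f | ∀ x : X, coact A C X (f x) = TensorOver.rT C f (coact A C X x)}
  mul_mem' {f g} hf hg x := by
    change coact A C X (f (g x)) = TensorOver.rT C (f ∘ₗ g) (coact A C X x)
    rw [hf, hg, TensorOver.rT_comp]
  one_mem' x := (TensorOver.rT_id _).symm
  add_mem' {f g} hf hg x := by
    rw [LinearMap.add_apply, map_add, hf, hg, TensorOver.rT_add]
  zero_mem' x := by
    have h := TensorOver.rT_add (M := C) (0 : Module.End Aᵐᵒᵖ X) 0 (coact A C X x)
    rw [add_zero, left_eq_add] at h
    rw [h, LinearMap.zero_apply, map_zero]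
  neg_mem' {f} hf x := by
    have h := TensorOver.rT_add (M := C) (-f) f (coact A C X x)
    have h0 := TensorOver.rT_add (M := C) (0 : Module.End Aᵐᵒᵖ X) 0 (coact A C X x)
    rw [add_zero, left_eq_add] at h0
    rw [neg_add_cancel, h0, ← hf] at h
    rw [LinearMap.neg_apply, map_neg]
    exact (eq_neg_of_add_eq_zero_left h.symm).symm

end Comodule

/-! ### Firm rings and firm modules -/

/-- The multiplication map `R ⊗_R R → R`. -/
def ringMulMap (R : Type*) [NonUnitalRing R] :
    BalTensor (fun r : R => AddMonoidHom.mulRight r) (fun r : R => AddMonoidHom.mulLeft r) →+ R :=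
  BalTensor.lift AddMonoidHom.mul (fun r x y => mul_assoc x r y)

/-- A (not necessarily unital) ring `R` is firm if multiplication `R ⊗_R R → R` is bijective. -/
def IsFirmRing (R : Type*) [NonUnitalRing R] : Prop := Function.Bijective (ringMulMap R)

section Bicomodule

/- An object of the category of `R`-`C`-bicomodules is a right `C`-comodule `X` with a left
`R`-module structure that commutes with the right `A`-action and for which the coaction is left
`R`-linear; this is the same as a ring homomorphism `j : R → End^C(X)`, and `r x = j r x`. -/

variable {A C X R : Type*} [Ring A] [AddCommGroup C] [Module A C] [Module Aᵐᵒᵖ C]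
  [SMulCommClass A Aᵐᵒᵖ C] [Coring A C] [AddCommGroup X] [Module Aᵐᵒᵖ X] [RightComodule A C X]
  [NonUnitalRing R]

/-- The left `R`-action on `X` given by `j`. -/
def endAct (j : R →ₙ+* ComodEnd A C X) (r : R) : X →+ X := (j r : Module.End Aᵐᵒᵖ X).toAddMonoidHom

/-- `R ⊗_R X`, for the left `R`-action on `X` given by `j`. -/
abbrev FirmPart (j : R →ₙ+* ComodEnd A C X) : Type _ :=
  BalTensor (fun r : R => AddMonoidHom.mulRight r) (endAct j)

/-- The multiplication map `R ⊗_R X → X`, `r ⊗ x ↦ r x`. -/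
def actMap (j : R →ₙ+* ComodEnd A C X) : FirmPart j →+ X :=
  BalTensor.lift (AddMonoidHom.mk' (endAct j) (fun r s => by
      ext x
      change (j (r + s) : Module.End Aᵐᵒᵖ X) x = _
      rw [map_add]
      rfl))
    (fun r s x => by
      change (j (s * r) : Module.End Aᵐᵒᵖ X) x = _
      rw [map_mul]
      rfl)

/-- `X` is firm as a left `R`-module: multiplication `R ⊗_R X → X` is bijective. -/
def IsFirmModule (j : R →ₙ+* ComodEnd A C X) : Prop := Function.Bijective (actMap j)

namespace FirmPart

/-- `(r ⊗ x) a = r ⊗ (x a)`. -/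
instance (j : R →ₙ+* ComodEnd A C X) :
    Module Aᵐᵒᵖ (BalTensor (fun r : R => AddMonoidHom.mulRight r) (endAct j)) :=
  BalTensor.moduleOfRight (fun r a x => map_smul (j r : Module.End Aᵐᵒᵖ X) a x)

/-- The right `A`-linear map `X → R ⊗_R X`, `x ↦ r ⊗ x`. -/
def incl (j : R →ₙ+* ComodEnd A C X) (r : R) : X →ₗ[Aᵐᵒᵖ] FirmPart j where
  toFun x := BalTensor.tmul _ _ r x
  map_add' x y := map_add _ x y
  map_smul' _ _ := rfl

theorem incl_add (j : R →ₙ+* ComodEnd A C X) (r s : R) : incl j (r + s) = incl j r + incl j s := by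
  ext x
  change BalTensor.tmul _ _ (r + s) x = BalTensor.tmul _ _ r x + BalTensor.tmul _ _ s x
  rw [map_add, AddMonoidHom.add_apply]

theorem incl_mul (j : R →ₙ+* ComodEnd A C X) (r s : R) :
    incl j (r * s) = incl j r ∘ₗ (j s : Module.End Aᵐᵒᵖ X) := by
  ext x
  exact BalTensor.tmul_balanced (α := fun r : R => AddMonoidHom.mulRight r) (β := endAct j) s r x

/-- The coaction `r ⊗ x ↦ (r ⊗ x₀) ⊗ x₁` on `R ⊗_R X`, as an additive map. -/
def coactHom (j : R →ₙ+* ComodEnd A C X) : FirmPart j →+ TensorOver A (FirmPart j) C :=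
  BalTensor.lift
    (AddMonoidHom.mk'
      (fun r => (TensorOver.rT C (incl j r)).comp (coact A C X).toAddMonoidHom)
      (fun r s => by
        ext x
        change TensorOver.rT C (incl j (r + s)) _ = _
        rw [incl_add, TensorOver.rT_add]
        rfl))
    (fun r s x => by
      change TensorOver.rT C (incl j (s * r)) (coact A C X x) =
        TensorOver.rT C (incl j s) (coact A C X ((j r : Module.End Aᵐᵒᵖ X) x))
      rw [(j r).2 x, incl_mul, TensorOver.rT_comp])

theorem coactHom_incl (j : R →ₙ+* ComodEnd A C X) (r : R) (x : X) :
    coactHom j (incl j r x) = TensorOver.rT C (incl j r) (coact A C X x) := rfl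

/-- The coaction `r ⊗ x ↦ (r ⊗ x₀) ⊗ x₁` on `R ⊗_R X`. -/
def coactLin (j : R →ₙ+* ComodEnd A C X) :
    FirmPart j →ₗ[Aᵐᵒᵖ] TensorOver A (FirmPart j) C where
  toFun := coactHom j
  map_add' := map_add _
  map_smul' a y := by
    induction y using BalTensor.induction with
    | tmul r x =>
      change coactHom j (incl j r (a • x)) = a • coactHom j (incl j r x)
      rw [coactHom_incl, coactHom_incl, map_smul, TensorOver.rT_op_smul]
    | add x y hx hy =>
      simp only [RingHom.id_apply] at hx hy ⊢
      rw [smul_add, map_add, hx, hy, map_add, smul_add]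

/-- The right `C`-comodule structure of `R ⊗_R X`. -/
instance (j : R →ₙ+* ComodEnd A C X) :
    RightComodule A C (BalTensor (fun r : R => AddMonoidHom.mulRight r) (endAct j)) where
  coact := coactLin j
  coassoc y := by
    induction y using BalTensor.induction with
    | tmul r x =>
      change TensorOver.assoc (TensorOver.rT C (coactLin j)
          (TensorOver.rT C (incl j r) (coact A C X x))) =
        TensorOver.lT _ (Coring.comul (A := A) (C := C)).left
          (TensorOver.rT C (incl j r) (coact A C X x))
      have h1 : coactLin j ∘ₗ incl j r =
          ({ toFun := TensorOver.rT C (incl j r)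
             map_add' := map_add _
             map_smul' := TensorOver.rT_op_smul _ } : TensorOver A X C →ₗ[Aᵐᵒᵖ] _) ∘ₗ
            coact A C X := rfl
      rw [← TensorOver.rT_comp, h1, TensorOver.rT_comp]
      have h2 : ∀ z : TensorOver A (TensorOver A X C) C,
          TensorOver.assoc (TensorOver.rT C ({ toFun := TensorOver.rT C (incl j r)
                                               map_add' := map_add _
                                               map_smul' := TensorOver.rT_op_smul _ } :
              TensorOver A X C →ₗ[Aᵐᵒᵖ] _) z) =
            TensorOver.rT (TensorOver A C C) (incl j r) (TensorOver.assoc z) := by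
        intro z
        induction z using BalTensor.induction with
        | tmul w c =>
          induction w using BalTensor.induction with
          | tmul x c' => rfl
          | add w w' h h' => simp only [map_add, AddMonoidHom.add_apply, h, h']
        | add w w' h h' => simp only [map_add, h, h']
      have h3 : ∀ z : TensorOver A X C,
          TensorOver.lT (FirmPart j) (Coring.comul (A := A) (C := C)).left
            (TensorOver.rT C (incl j r) z) =
          TensorOver.rT (TensorOver A C C) (incl j r)
            (TensorOver.lT X (Coring.comul (A := A) (C := C)).left z) := by
        intro z
        induction z using BalTensor.induction with
        | tmul x c => rfl
        | add w w' h h' => simp only [map_add, h, h']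
      rw [h2, h3, RightComodule.coassoc]
    | add x y hx hy => simp only [map_add, hx, hy]
  counit y := by
    induction y using BalTensor.induction with
    | tmul r x =>
      change TensorOver.rUnit (TensorOver.lT _ (Coring.counit (A := A) (C := C)).left
          (TensorOver.rT C (incl j r) (coact A C X x))) = incl j r x
      have h : ∀ z : TensorOver A X C,
          TensorOver.rUnit (TensorOver.lT (FirmPart j) (Coring.counit (A := A) (C := C)).left
            (TensorOver.rT C (incl j r) z)) =
          incl j r (TensorOver.rUnit (TensorOver.lT X (Coring.counit (A := A) (C := C)).left z)) := by
        intro z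
        induction z using BalTensor.induction with
        | tmul x c => rfl
        | add w w' h h' => simp only [map_add, h, h']
      rw [h, RightComodule.counit]
    | add x y hx hy => simp only [map_add, hx, hy]

/-- Left multiplication `s ⊗ x ↦ r s ⊗ x` on `R ⊗_R X`, as a right `A`-linear map. -/
def lmul (j : R →ₙ+* ComodEnd A C X) (r : R) : FirmPart j →ₗ[Aᵐᵒᵖ] FirmPart j where
  toFun := BalTensor.lift ((BalTensor.tmul _ _).comp (AddMonoidHom.mulLeft r))
    (fun t s x => by
      change BalTensor.tmul _ _ (r * (s * t)) x = BalTensor.tmul _ _ (r * s) (endAct j t x)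
      rw [← mul_assoc]
      exact BalTensor.tmul_balanced (α := fun r : R => AddMonoidHom.mulRight r) t (r * s) x)
  map_add' := map_add _
  map_smul' a y := by
    induction y using BalTensor.induction with
    | tmul s x => rfl
    | add x y hx hy =>
      simp only [RingHom.id_apply] at hx hy ⊢
      rw [smul_add, map_add, hx, hy, map_add, smul_add]

theorem lmul_incl (j : R →ₙ+* ComodEnd A C X) (r s : R) : lmul j r ∘ₗ incl j s = incl j (r * s) :=
  rfl

/-- The left `R`-module structure `r (s ⊗ x) = r s ⊗ x` on `R ⊗_R X`, which makes `R ⊗_R X` an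
`R`-`C`-bicomodule. -/
def toEnd (j : R →ₙ+* ComodEnd A C X) : R →ₙ+* ComodEnd A C (FirmPart j) where
  toFun r := ⟨lmul j r, fun y => by
    induction y using BalTensor.induction with
    | tmul s x =>
      change TensorOver.rT C (incl j (r * s)) (coact A C X x) =
        TensorOver.rT C (lmul j r) (TensorOver.rT C (incl j s) (coact A C X x))
      rw [← TensorOver.rT_comp, lmul_incl]
    | add x y hx hy => simp only [map_add, hx, hy]⟩
  map_mul' r s := by
    ext y
    change lmul j (r * s) y = lmul j r (lmul j s y)
    induction y using BalTensor.induction with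
    | tmul t x =>
      change BalTensor.tmul _ _ (r * s * t) x = BalTensor.tmul _ _ (r * (s * t)) x
      rw [mul_assoc]
    | add x y hx hy => simp only [map_add, hx, hy]
  map_zero' := by
    ext y
    change lmul j 0 y = 0
    induction y using BalTensor.induction with
    | tmul t x =>
      change BalTensor.tmul _ _ (0 * t) x = 0
      rw [zero_mul, map_zero, AddMonoidHom.zero_apply]
    | add x y hx hy => simp only [map_add, hx, hy, add_zero]
  map_add' r s := by
    ext y
    change lmul j (r + s) y = lmul j r y + lmul j s y
    induction y using BalTensor.induction with
    | tmul t x =>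
      change BalTensor.tmul _ _ ((r + s) * t) x =
        BalTensor.tmul _ _ (r * t) x + BalTensor.tmul _ _ (s * t) x
      rw [add_mul, map_add, AddMonoidHom.add_apply]
    | add x y hx hy => simp only [map_add, hx, hy]; abel

end FirmPart

/-! ### The canonical maps -/

/-- The right `R`-action `(f r)(x) = f (r x)` on `Hom_A(X, M)`. -/
def homAct (j : R →ₙ+* ComodEnd A C X) (M : Type*) [AddCommGroup M] [Module Aᵐᵒᵖ M] (r : R) :
    (X →ₗ[Aᵐᵒᵖ] M) →+ (X →ₗ[Aᵐᵒᵖ] M) :=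
  AddMonoidHom.mk' (fun f => f ∘ₗ (j r : Module.End Aᵐᵒᵖ X)) (fun f g => LinearMap.add_comp _ g f)

/-- The canonical map `can_M : Hom_A(X, M) ⊗_R X → M ⊗_A C`, `f ⊗ x ↦ f(x₀) ⊗ x₁`. -/
def canM (j : R →ₙ+* ComodEnd A C X) (M : Type*) [AddCommGroup M] [Module Aᵐᵒᵖ M] :
    BalTensor (homAct j M) (endAct j) →+ TensorOver A M C :=
  BalTensor.lift
    (AddMonoidHom.mk'
      (fun f : X →ₗ[Aᵐᵒᵖ] M => (TensorOver.rT C f).comp (coact A C X).toAddMonoidHom)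
      (fun f g => by ext x; exact TensorOver.rT_add f g _))
    (fun r f x => by
      change TensorOver.rT C (f ∘ₗ (j r : Module.End Aᵐᵒᵖ X)) (coact A C X x) =
        TensorOver.rT C f (coact A C X ((j r : Module.End Aᵐᵒᵖ X) x))
      rw [(j r).2 x, TensorOver.rT_comp])

/-- The canonical map `can : X* ⊗_R X → C`, `f ⊗ x ↦ f(x₀) x₁`, where `X* = Hom_A(X, A)`. -/
def can (j : R →ₙ+* ComodEnd A C X) : BalTensor (homAct j A) (endAct j) →+ C :=
  TensorOver.lUnit.comp (canM j A)

end Bicomodule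

/-! ### The elementary ring of a right module -/

section Elementary

variable (A X : Type*) [Ring A] [AddCommGroup X] [Module Aᵐᵒᵖ X]

/-- `Z = X ⊗_A X*`, where `X* = Hom_A(X, A)` has the left `A`-action `(a f)(x) = a f(x)`. -/
def ElementaryRing : Type _ := TensorOver A X (X →ₗ[Aᵐᵒᵖ] A)

namespace ElementaryRing

instance : AddCommGroup (ElementaryRing A X) :=
  inferInstanceAs (AddCommGroup (TensorOver A X (X →ₗ[Aᵐᵒᵖ] A)))

/-- The left action `(u ⊗ f) x = u f(x)` of `Z = X ⊗_A X*` on `X`. -/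
def act : ElementaryRing A X →+ Module.End Aᵐᵒᵖ X :=
  BalTensor.lift (α := rightAct A X) (β := leftAct A (X →ₗ[Aᵐᵒᵖ] A))
    (AddMonoidHom.mk' (fun u => AddMonoidHom.mk'
      (fun f : X →ₗ[Aᵐᵒᵖ] A =>
        ({ toFun := fun x => op (f x) • u
           map_add' := fun x y => by rw [map_add, MulOpposite.op_add, add_smul]
           map_smul' := fun a x => by
            rw [map_smul, RingHom.id_apply, ← mul_smul]
            rfl } : Module.End Aᵐᵒᵖ X))
      (fun f g => by
        ext x
        exact (congrArg (· • u) (MulOpposite.op_add (f x) (g x))).trans (add_smul _ _ u)))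
      (fun u v => by
        ext f x
        exact smul_add (op (f x)) u v))
    (fun a u f => by
      ext x
      change op (f x) • op a • u = op (a * f x) • u
      rw [MulOpposite.op_mul, mul_smul])

theorem act_rT (z w : ElementaryRing A X) :
    act A X (TensorOver.rT (X →ₗ[Aᵐᵒᵖ] A) (act A X z) w) = act A X z ∘ₗ act A X w := by
  let T : ElementaryRing A X →+ ElementaryRing A X :=
    TensorOver.rT (X →ₗ[Aᵐᵒᵖ] A) (act A X z)
  let L : Module.End Aᵐᵒᵖ X →+ Module.End Aᵐᵒᵖ X := AddMonoidHom.mulLeft (act A X z)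
  refine DFunLike.congr_fun (f := (act A X).comp T) (g := L.comp (act A X))
    (BalTensor.hom_ext fun v g => ?_) w
  ext x
  exact (map_smul (act A X z) (op (g x)) v).symm

/-- The multiplication `(u ⊗ f)(v ⊗ g) = u f(v) ⊗ g` of `Z = X ⊗_A X*`. -/
instance : NonUnitalRing (ElementaryRing A X) where
  mul z w := TensorOver.rT (X →ₗ[Aᵐᵒᵖ] A) (act A X z) w
  left_distrib z w w' := map_add (TensorOver.rT (X →ₗ[Aᵐᵒᵖ] A) (act A X z)) w w'
  right_distrib z z' w := by
    change TensorOver.rT (X →ₗ[Aᵐᵒᵖ] A) (act A X (z + z')) w = _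
    rw [map_add]
    exact TensorOver.rT_add _ _ w
  zero_mul w := by
    change TensorOver.rT (X →ₗ[Aᵐᵒᵖ] A) (act A X 0) w = 0
    rw [map_zero]
    have h := TensorOver.rT_add (0 : Module.End Aᵐᵒᵖ X) 0 w
    rwa [add_zero, left_eq_add] at h
  mul_zero z := map_zero (TensorOver.rT (X →ₗ[Aᵐᵒᵖ] A) (act A X z))
  mul_assoc z w x := by
    change TensorOver.rT (X →ₗ[Aᵐᵒᵖ] A)
      (act A X (TensorOver.rT (X →ₗ[Aᵐᵒᵖ] A) (act A X z) w)) x = _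
    rw [act_rT]
    exact TensorOver.rT_comp _ _ x

end ElementaryRing

end Elementary

/-! ### Galois comodules -/

section Galois

variable {A C X R : Type*} [Ring A] [AddCommGroup C] [Module A C] [Module Aᵐᵒᵖ C]
  [SMulCommClass A Aᵐᵒᵖ C] [Coring A C] [AddCommGroup X] [Module Aᵐᵒᵖ X] [RightComodule A C X]
  [NonUnitalRing R]

/-- `X` is `R`-firmly projective as a `C`-comodule: it is a firm left `R`-module, and its `R`-action
(by colinear maps) is induced by a ring morphism `ι : R → X ⊗_A X*`. -/
def IsFirmlyProjective (j : R →ₙ+* ComodEnd A C X) : Prop :=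
  IsFirmModule j ∧ ∃ ι : R →ₙ+* ElementaryRing A X,
    ∀ r : R, (j r : Module.End Aᵐᵒᵖ X) = ElementaryRing.act A X (ι r)

/-- `X` is an `R`-`C` Galois comodule: it is `R`-firmly projective as a `C`-comodule, and
`can : X* ⊗_R X → C` is an isomorphism. -/
def IsGaloisComodule (j : R →ₙ+* ComodEnd A C X) : Prop :=
  IsFirmlyProjective j ∧ Function.Bijective (can j)

/-- The `R`-`C`-bicomodule `X` is an `R`-`C` comonadic-Galois comodule: it is a firm left `R`-module
and `can_M : Hom_A(X, M) ⊗_R X → M ⊗_A C` is an isomorphism for every right `A`-module `M`. -/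
def IsComonadicGalois.{w, uA, uC, uX, uR} {A : Type uA} {C : Type uC} {X : Type uX} {R : Type uR}
    [Ring A] [AddCommGroup C] [Module A C] [Module Aᵐᵒᵖ C] [SMulCommClass A Aᵐᵒᵖ C] [Coring A C]
    [AddCommGroup X] [Module Aᵐᵒᵖ X] [RightComodule A C X] [NonUnitalRing R]
    (j : R →ₙ+* ComodEnd A C X) : Prop :=
  IsFirmModule j ∧
    ∀ (M : Type w) [AddCommGroup M] [Module Aᵐᵒᵖ M], Function.Bijective (canM j M)

end Galois

universe uA uC uX uR uS w

/-! Write `μ : S ⊗_S X → X` for the action map. Firmness of `S ⊗_S X` comes from `S ⊗_S (S ⊗_S X) ≅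
(S ⊗_S S) ⊗_S X` and the firmness of `S` (`FirmPart.isFirmModule`); `X` itself need not be firm over
`S`. Bijectivity of `can_M` is proved over `R` and then carried to `S`.

Over `R` (`IsGaloisComodule.canM_bijective`): tensoring `can` with `M` gives `M ⊗_A X* ⊗_R X ≅ M ⊗_A
C`, so the point is to replace `M ⊗_A X*` by `Hom_A(X, M)`. Since `X = R X`, it suffices to treat `f
⊗ r y = f r ⊗ y`. If `ι r = ∑ u ⊗ g`, then `f r = ∑ f(u) g(-)` comes from `M ⊗_A X*`.

From `R` to `S` (`canM_toEnd_bijective`): firmness over `R` gives an `R`-linear section `σ` of `μ`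
with `σ (r x) = i r ⊗ x`. The map `Φ : g ⊗ x ↦ g μ ⊗ σ x` from `Hom_A(X, M) ⊗_R X` to `Hom_A(S ⊗_S
X, M) ⊗_S (S ⊗_S X)` is compatible with the two canonical maps. It is surjective because
multiplication by `s` on `S ⊗_S X` factors through `μ` (`FirmPart.lmul_eq`), and injective because
its composite with `can_M` is. Hence `can_M` is bijective over `S` too. -/

/-! ### Additive maps out of firm rings and firm modules -/

section Preliminaries

variable {A C X R : Type*} [Ring A] [AddCommGroup C] [Module A C] [Module Aᵐᵒᵖ C]
  [SMulCommClass A Aᵐᵒᵖ C] [Coring A C] [AddCommGroup X] [Module Aᵐᵒᵖ X] [RightComodule A C X]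
  [NonUnitalRing R]

/-- To check that two additive maps out of a firm left `R`-module agree, it suffices to look at
elements of the form `r x`. -/
theorem IsFirmModule.hom_ext {P : Type*} [AddCommGroup P] {j : R →ₙ+* ComodEnd A C X}
    (hj : IsFirmModule j) {f g : X →+ P}
    (h : ∀ r x, f ((j r : Module.End Aᵐᵒᵖ X) x) = g ((j r : Module.End Aᵐᵒᵖ X) x)) : f = g := by
  ext x
  obtain ⟨z, rfl⟩ := hj.2 x
  exact DFunLike.congr_fun (f := f.comp (actMap j)) (g := g.comp (actMap j))
    (BalTensor.hom_ext h) z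

/-- To check that two additive maps out of a firm ring agree, it suffices to look at products. -/
theorem IsFirmRing.hom_ext {P : Type*} [AddCommGroup P] (hR : IsFirmRing R) {f g : R →+ P}
    (h : ∀ r s, f (r * s) = g (r * s)) : f = g := by
  ext x
  obtain ⟨z, rfl⟩ := hR.2 x
  exact DFunLike.congr_fun (f := f.comp (ringMulMap R)) (g := g.comp (ringMulMap R))
    (BalTensor.hom_ext h) z

/-- The multiplication map `R ⊗_R X → X` as a right `A`-linear map. -/
def actMapLin (j : R →ₙ+* ComodEnd A C X) : FirmPart j →ₗ[Aᵐᵒᵖ] X where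
  toFun := actMap j
  map_add' := map_add _
  map_smul' a y := by
    induction y using BalTensor.induction with
    | tmul r x => exact map_smul (j r : Module.End Aᵐᵒᵖ X) a x
    | add x y hx hy =>
      simp only [RingHom.id_apply] at hx hy ⊢
      rw [smul_add, map_add, hx, hy, map_add, smul_add]

theorem canM_tmul (j : R →ₙ+* ComodEnd A C X) (M : Type*) [AddCommGroup M] [Module Aᵐᵒᵖ M]
    (f : X →ₗ[Aᵐᵒᵖ] M) (x : X) :
    canM j M (BalTensor.tmul _ _ f x) = TensorOver.rT C f (coact A C X x) := rfl

end Preliminaries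

/-! ### Firmness of `S ⊗_S X`, and its action map to `X` -/

section FirmPartFirm

variable {A C X S : Type*} [Ring A] [AddCommGroup C] [Module A C] [Module Aᵐᵒᵖ C]
  [SMulCommClass A Aᵐᵒᵖ C] [Coring A C] [AddCommGroup X] [Module Aᵐᵒᵖ X] [RightComodule A C X]
  [NonUnitalRing S]

namespace FirmPart

/-- The map `s ⊗ t ↦ s ⊗ (t ⊗ x)` from `S ⊗_S S` to `S ⊗_S (S ⊗_S X)`, additively in `x`. -/
def tensorIncl (j : S →ₙ+* ComodEnd A C X) (x : X) :
    BalTensor (fun r : S => AddMonoidHom.mulRight r) (fun r : S => AddMonoidHom.mulLeft r) →+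
      FirmPart (toEnd j) :=
  BalTensor.lift ((BalTensor.tmul _ _).compl₂
      ((BalTensor.tmul (fun r : S => AddMonoidHom.mulRight r) (endAct j)).flip x))
    (fun r s t => BalTensor.tmul_balanced (α := fun r : S => AddMonoidHom.mulRight r)
      (β := endAct (toEnd j)) r s (incl j t x))

theorem tensorIncl_add (j : S →ₙ+* ComodEnd A C X) (x y : X) :
    tensorIncl j (x + y) = tensorIncl j x + tensorIncl j y := by
  refine BalTensor.hom_ext fun s t => ?_
  change BalTensor.tmul _ (endAct (toEnd j)) s (incl j t (x + y)) =
    BalTensor.tmul _ _ s (incl j t x) + BalTensor.tmul _ _ s (incl j t y)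
  rw [map_add, map_add]

/-- Inverting `S ⊗_S S → S` makes `s t ⊗ x ↦ s ⊗ (t ⊗ x)` well defined, and this rebracketing is the
inverse of the action map. Only `S` has to be firm. -/
theorem isFirmModule (hS : IsFirmRing S) (j : S →ₙ+* ComodEnd A C X) :
    IsFirmModule (toEnd j) := by
  let e := AddEquiv.ofBijective (ringMulMap S) hS
  have he : ∀ s t : S, e.symm (s * t) = BalTensor.tmul _ _ s t := fun s t =>
    (AddEquiv.symm_apply_eq e).2 rfl
  let F : S →+ X →+ FirmPart (toEnd j) :=
    (AddMonoidHom.mk' (fun x => (tensorIncl j x).comp e.symm.toAddMonoidHom)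
      (fun x y => by rw [tensorIncl_add]; rfl)).flip
  have hF : ∀ s t x, F (s * t) x = BalTensor.tmul _ (endAct (toEnd j)) s (incl j t x) := by
    intro s t x
    change tensorIncl j x (e.symm (s * t)) = _
    rw [he]
    rfl
  let G : FirmPart j →+ FirmPart (toEnd j) := BalTensor.lift F (fun r s x => by
    -- Balancedness over `S` is tested on products `s = a b`, where it reads `a ⊗ (b r ⊗ x) = a ⊗ (b
    -- ⊗ r x)`.
    refine DFunLike.congr_fun (f := (F.flip x).comp (AddMonoidHom.mulRight r))
      (g := F.flip (endAct j r x)) (hS.hom_ext fun a b => ?_) s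
    change F (a * b * r) x = F (a * b) (endAct j r x)
    rw [mul_assoc, hF, hF, incl_mul]
    rfl)
  constructor
  · refine Function.LeftInverse.injective (g := G) fun z => ?_
    refine DFunLike.congr_fun (f := G.comp (actMap (toEnd j))) (g := AddMonoidHom.id _)
      (BalTensor.hom_ext fun s y => ?_) z
    induction y using BalTensor.induction with
    | tmul t x => exact hF s t x
    | add x y hx hy => rw [map_add, map_add, map_add, hx, hy]
  · refine Function.RightInverse.surjective (g := G) fun z => ?_
    refine DFunLike.congr_fun (f := (actMap (toEnd j)).comp G) (g := AddMonoidHom.id _)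
      (BalTensor.hom_ext fun s x => ?_) z
    let T := BalTensor.tmul (fun r : S => AddMonoidHom.mulRight r) (endAct j)
    refine DFunLike.congr_fun (f := (actMap (toEnd j)).comp (F.flip x)) (g := T.flip x)
      (hS.hom_ext fun a b => ?_) s
    change actMap (toEnd j) (F (a * b) x) = T (a * b) x
    rw [hF]
    rfl

/-- Balancedness gives `s t ⊗ x = s ⊗ t x`, so multiplication by `s` passes through `X`. A map
precomposed with it is therefore determined by a map on `X`, which is what makes `Φ` surjective in
`canM_toEnd_bijective`. -/
theorem lmul_eq (j : S →ₙ+* ComodEnd A C X) (s : S) : lmul j s = incl j s ∘ₗ actMapLin j := by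
  ext y
  induction y using BalTensor.induction with
  | tmul t x => exact LinearMap.congr_fun (incl_mul j s t) x
  | add x y hx hy => rw [map_add, map_add, hx, hy]

theorem actMapLin_incl (j : S →ₙ+* ComodEnd A C X) (s : S) :
    actMapLin j ∘ₗ incl j s = (j s : Module.End Aᵐᵒᵖ X) := rfl

theorem actMapLin_lmul (j : S →ₙ+* ComodEnd A C X) (s : S) :
    actMapLin j ∘ₗ lmul j s = (j s : Module.End Aᵐᵒᵖ X) ∘ₗ actMapLin j := by
  rw [lmul_eq, ← LinearMap.comp_assoc, actMapLin_incl]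

end FirmPart

end FirmPartFirm

/-! ### Bijectivity of `can_M` over `R` for a Galois comodule -/

section GaloisIsComonadic

variable {A C X R : Type*} [Ring A] [AddCommGroup C] [Module A C] [Module Aᵐᵒᵖ C]
  [SMulCommClass A Aᵐᵒᵖ C] [Coring A C] [AddCommGroup X] [Module Aᵐᵒᵖ X] [RightComodule A C X]
  [NonUnitalRing R] (j : R →ₙ+* ComodEnd A C X) {M : Type*} [AddCommGroup M] [Module Aᵐᵒᵖ M]

/-- The right `A`-linear map `A → M`, `a ↦ m a`. -/
def orbitMap (m : M) : A →ₗ[Aᵐᵒᵖ] M where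
  toFun a := op a • m
  map_add' a b := by rw [MulOpposite.op_add, add_smul]
  map_smul' a b := by
    rw [RingHom.id_apply, ← mul_smul]
    rfl

theorem orbitMap_apply (m : M) (a : A) : orbitMap m a = op a • m := rfl

theorem orbitMap_add (m n : M) : orbitMap (A := A) (m + n) = orbitMap m + orbitMap n := by
  ext
  simp [orbitMap_apply]

theorem orbitMap_op_smul (a : A) (m : M) (g : X →ₗ[Aᵐᵒᵖ] A) :
    orbitMap (op a • m) ∘ₗ g = orbitMap m ∘ₗ (a • g) := by
  ext x
  change op (g x) • op a • m = op (a * g x) • m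
  rw [MulOpposite.op_mul, mul_smul]

/-- The operator `u ⊗ g` factors through `A`, so `f` enters only by its value at `u`. This turns
elements of `Hom_A(X, M)` into elements coming from `M ⊗_A X*`. -/
theorem comp_act_tmul (f : X →ₗ[Aᵐᵒᵖ] M) (u : X) (g : X →ₗ[Aᵐᵒᵖ] A) :
    f ∘ₗ ElementaryRing.act A X (TensorOver.mk A u g) = orbitMap (f u) ∘ₗ g := by
  ext x
  exact map_smul f (op (g x)) u

/-- Postcomposition with `a ↦ m a`, as a map `X* ⊗_R X → Hom_A(X, M) ⊗_R X`. -/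
def orbitTensor (m : M) :
    BalTensor (homAct j A) (endAct j) →+ BalTensor (homAct j M) (endAct j) :=
  BalTensor.lift
    ((BalTensor.tmul _ _).comp (AddMonoidHom.mk' (fun g : X →ₗ[Aᵐᵒᵖ] A => orbitMap m ∘ₗ g)
      (fun g h => LinearMap.comp_add g h _)))
    (fun r g x => BalTensor.tmul_balanced (α := homAct j M) (β := endAct j) r
      (orbitMap m ∘ₗ g) x)

theorem orbitTensor_tmul (m : M) (g : X →ₗ[Aᵐᵒᵖ] A) (x : X) :
    orbitTensor j m (BalTensor.tmul _ _ g x) = BalTensor.tmul _ _ (orbitMap m ∘ₗ g) x := rfl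

theorem orbitTensor_add (m n : M) :
    orbitTensor j (m + n) = orbitTensor j m + orbitTensor j n := by
  refine BalTensor.hom_ext fun g x => ?_
  rw [AddMonoidHom.add_apply, orbitTensor_tmul, orbitTensor_tmul, orbitTensor_tmul, orbitMap_add,
    LinearMap.add_comp, map_add, AddMonoidHom.add_apply]

/-- The left `A`-action `a (g ⊗ x) = a g ⊗ x` on `X* ⊗_R X`. -/
def dualTensorSMul (a : A) :
    BalTensor (homAct j A) (endAct j) →+ BalTensor (homAct j A) (endAct j) :=
  BalTensor.mapLeft (DistribSMul.toAddMonoidHom (X →ₗ[Aᵐᵒᵖ] A) a) (fun _ _ => rfl)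

theorem dualTensorSMul_tmul (a : A) (g : X →ₗ[Aᵐᵒᵖ] A) (x : X) :
    dualTensorSMul j a (BalTensor.tmul _ _ g x) = BalTensor.tmul _ _ (a • g) x := rfl

/-- Left `A`-linearity of `can` passes to its inverse, as needed for the inverse of `can_M` to be
balanced over `A`. -/
theorem can_dualTensorSMul (a : A) (z : BalTensor (homAct j A) (endAct j)) :
    can j (dualTensorSMul j a z) = a • can j z := by
  induction z using BalTensor.induction with
  | tmul g x =>
    rw [dualTensorSMul_tmul]
    change TensorOver.lUnit (TensorOver.rT C (a • g) (coact A C X x)) =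
      a • TensorOver.lUnit (TensorOver.rT C g (coact A C X x))
    induction coact A C X x using BalTensor.induction with
    | tmul y c => exact mul_smul a (g y) c
    | add y z hy hz => simp only [map_add, smul_add, hy, hz]
  | add x y hx hy => simp only [map_add, smul_add, hx, hy]

theorem orbitTensor_op_smul (a : A) (m : M) (z : BalTensor (homAct j A) (endAct j)) :
    orbitTensor j (op a • m) z = orbitTensor j m (dualTensorSMul j a z) := by
  induction z using BalTensor.induction with
  | tmul g x => rw [dualTensorSMul_tmul, orbitTensor_tmul, orbitTensor_tmul, orbitMap_op_smul]
  | add x y hx hy => rw [map_add, map_add, map_add, hx, hy]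

/-- On `g ⊗ x` this is the relation `m g(x₀) ⊗ x₁ = m ⊗ g(x₀) x₁` over `A`. It identifies `can_M`,
on the part coming from `M ⊗_A X*`, with `M ⊗_A can`. -/
theorem canM_orbitTensor (m : M) (z : BalTensor (homAct j A) (endAct j)) :
    canM j M (orbitTensor j m z) = TensorOver.mk A m (can j z) := by
  induction z using BalTensor.induction with
  | tmul g x =>
    rw [orbitTensor_tmul, canM_tmul]
    change _ = TensorOver.mk A m (TensorOver.lUnit (TensorOver.rT C g (coact A C X x)))
    induction coact A C X x using BalTensor.induction with
    | tmul y c =>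
      exact BalTensor.tmul_balanced (α := rightAct A M) (β := leftAct A C) (g y) m c
    | add y z hy hz => simp only [map_add, hy, hz]
  | add x y hx hy => simp only [map_add, hx, hy]

variable {j}

theorem IsGaloisComodule.canM_bijective (hX : IsGaloisComodule j)
    (M : Type*) [AddCommGroup M] [Module Aᵐᵒᵖ M] : Function.Bijective (canM j M) := by
  obtain ⟨⟨hfirm, ι, hι⟩, hcan⟩ := hX
  let e := AddEquiv.ofBijective (can j) hcan
  have hsymm : ∀ (a : A) (c : C), e.symm (a • c) = dualTensorSMul j a (e.symm c) := fun a c => by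
    rw [AddEquiv.symm_apply_eq]
    change _ = can j _
    rw [can_dualTensorSMul]
    exact congrArg (a • ·) (e.apply_symm_apply c).symm
  -- The candidate inverse: `m ⊗ c` goes to `can⁻¹ c` with `a ↦ m a` applied to its `X*`-factor.
  let Ψ : TensorOver A M C →+ BalTensor (homAct j M) (endAct j) :=
    BalTensor.lift
      (AddMonoidHom.mk' (fun m => (orbitTensor j m).comp e.symm.toAddMonoidHom)
        (fun m n => by rw [orbitTensor_add]; rfl))
      (fun a m c => by
        change orbitTensor j (op a • m) (e.symm c) = orbitTensor j m (e.symm (a • c))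
        rw [hsymm, orbitTensor_op_smul])
  have hΨ : ∀ m z, Ψ (TensorOver.mk A m (can j z)) = orbitTensor j m z := fun m z =>
    congrArg (orbitTensor j m) (e.symm_apply_apply z)
  constructor
  · refine Function.LeftInverse.injective (g := Ψ) fun z => ?_
    refine DFunLike.congr_fun (f := Ψ.comp (canM j M)) (g := AddMonoidHom.id _)
      (BalTensor.hom_ext fun f x => ?_) z
    -- By firmness of `X` it is enough to take `x = r y`, so that `r` can be moved onto `f` and
    -- replaced by `ι r`.
    refine DFunLike.congr_fun (f := (Ψ.comp (canM j M)).comp (BalTensor.tmul _ _ f))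
      (g := BalTensor.tmul _ _ f) (hfirm.hom_ext fun r y => ?_) x
    have hb : BalTensor.tmul (homAct j M) (endAct j) f ((j r : Module.End Aᵐᵒᵖ X) y) =
        BalTensor.tmul _ _ (f ∘ₗ ElementaryRing.act A X (ι r)) y := by
      rw [← hι]
      exact (BalTensor.tmul_balanced (α := homAct j M) (β := endAct j) r f y).symm
    -- Stated for every `w` in `X ⊗_A X*`, not just `ι r`, so that additivity reduces it to pure
    -- tensors.
    have hz : ∀ w : ElementaryRing A X,
        Ψ (canM j M (BalTensor.tmul _ _ (f ∘ₗ ElementaryRing.act A X w) y)) =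
          BalTensor.tmul _ _ (f ∘ₗ ElementaryRing.act A X w) y := by
      intro w
      induction w using BalTensor.induction with
      | tmul u g =>
        rw [comp_act_tmul, ← orbitTensor_tmul, canM_orbitTensor, hΨ]
      | add v w hv hw =>
        have hvw : f ∘ₗ ElementaryRing.act A X (v + w) =
            f ∘ₗ ElementaryRing.act A X v + f ∘ₗ ElementaryRing.act A X w := by
          rw [← LinearMap.comp_add]
          exact congrArg (f ∘ₗ ·) (map_add (ElementaryRing.act A X) v w)
        rw [hvw, map_add, AddMonoidHom.add_apply, map_add, map_add, hv, hw]
    change Ψ (canM j M (BalTensor.tmul _ _ f _)) = BalTensor.tmul _ _ f _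
    rw [hb]
    exact hz (ι r)
  · refine Function.RightInverse.surjective (g := Ψ) fun z => ?_
    refine DFunLike.congr_fun (f := (canM j M).comp Ψ) (g := AddMonoidHom.id _)
      (BalTensor.hom_ext fun m c => ?_) z
    change canM j M (orbitTensor j m (e.symm c)) = TensorOver.mk A m c
    rw [canM_orbitTensor]
    exact congrArg _ (e.apply_symm_apply c)

end GaloisIsComonadic

/-! ### Transfer of bijectivity from `R` to `S` -/

section ChangeOfRing

variable {A C X R S : Type*} [Ring A] [AddCommGroup C] [Module A C] [Module Aᵐᵒᵖ C]
  [SMulCommClass A Aᵐᵒᵖ C] [Coring A C] [AddCommGroup X] [Module Aᵐᵒᵖ X] [RightComodule A C X]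
  [NonUnitalRing R] [NonUnitalRing S]

/-- The map `R ⊗_R X → S ⊗_S X`, `r ⊗ x ↦ i r ⊗ x`. -/
def FirmPart.changeRing (i : R →ₙ+* S) (j : S →ₙ+* ComodEnd A C X) :
    FirmPart (j.comp i) →+ FirmPart j :=
  BalTensor.lift ((BalTensor.tmul _ _).comp (i : R →+ S)) (fun r s x => by
    change BalTensor.tmul _ _ (i (s * r)) x = BalTensor.tmul _ _ (i s) (endAct j (i r) x)
    rw [map_mul]
    exact BalTensor.tmul_balanced (α := fun r : S => AddMonoidHom.mulRight r) (β := endAct j)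
      (i r) (i s) x)

/-- If `X` is firm over `R` and `R → S`, then `can_M` for the `S`-module `S ⊗_S X` is bijective
as soon as `can_M` for the `R`-module `X` is. -/
theorem canM_toEnd_bijective (i : R →ₙ+* S) (j : S →ₙ+* ComodEnd A C X)
    (hfirm : IsFirmModule (j.comp i)) (M : Type*) [AddCommGroup M] [Module Aᵐᵒᵖ M]
    (h : Function.Bijective (canM (j.comp i) M)) :
    Function.Bijective (canM (FirmPart.toEnd j) M) := by
  let e := AddEquiv.ofBijective (actMap (j.comp i)) hfirm
  -- The composite `X ≅ R ⊗_R X → S ⊗_S X`, a section of `μ`.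
  let σ : X →+ FirmPart j := (FirmPart.changeRing i j).comp e.symm.toAddMonoidHom
  have hσ : ∀ r x, σ ((j (i r) : Module.End Aᵐᵒᵖ X) x) = FirmPart.incl j (i r) x := fun r x =>
    congrArg (FirmPart.changeRing i j) (e.symm_apply_apply (BalTensor.tmul _ _ r x))
  -- `σ` is `R`-linear: on `x = s y` both sides are `i r * i s ⊗ y`.
  have hσ_mul : ∀ r x, σ ((j (i r) : Module.End Aᵐᵒᵖ X) x) = FirmPart.lmul j (i r) (σ x) := by
    intro r x
    refine DFunLike.congr_fun (f := σ.comp (endAct j (i r)))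
      (g := (FirmPart.lmul j (i r)).toAddMonoidHom.comp σ) (hfirm.hom_ext fun s y => ?_) x
    change σ ((j (i r) : Module.End Aᵐᵒᵖ X) ((j (i s) : Module.End Aᵐᵒᵖ X) y)) =
      FirmPart.lmul j (i r) (σ ((j (i s) : Module.End Aᵐᵒᵖ X) y))
    rw [hσ, hσ]
    exact (LinearMap.congr_fun (FirmPart.incl_mul j (i r) (i s)) y).symm
  let Φ : BalTensor (homAct (j.comp i) M) (endAct (j.comp i)) →+
      BalTensor (homAct (FirmPart.toEnd j) M) (endAct (FirmPart.toEnd j)) :=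
    BalTensor.lift
      (((BalTensor.tmul _ _).comp (AddMonoidHom.mk'
        (fun g : X →ₗ[Aᵐᵒᵖ] M => g ∘ₗ actMapLin j) (fun f g => LinearMap.add_comp _ g f))).compl₂ σ)
      (fun r g x => by
        change BalTensor.tmul _ _
            ((g ∘ₗ (j (i r) : Module.End Aᵐᵒᵖ X)) ∘ₗ actMapLin j) (σ x) =
          BalTensor.tmul _ _ (g ∘ₗ actMapLin j) (σ ((j (i r) : Module.End Aᵐᵒᵖ X) x))
        -- As `μ` commutes with `i r`, the scalar sits next to the tensor sign and crosses it by
        -- balancedness over `S`.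
        rw [hσ_mul, LinearMap.comp_assoc, ← FirmPart.actMapLin_lmul, ← LinearMap.comp_assoc]
        exact BalTensor.tmul_balanced (α := homAct (FirmPart.toEnd j) M)
          (β := endAct (FirmPart.toEnd j)) (i r) (g ∘ₗ actMapLin j) (σ x))
  -- On `r y`, the coaction of `i r ⊗ y` is `(i r ⊗ y₀) ⊗ y₁`, and `μ` sends `i r ⊗ y₀` to `r y₀`;
  -- colinearity of `r` finishes.
  have hcomp : (canM (FirmPart.toEnd j) M).comp Φ = canM (j.comp i) M := by
    refine BalTensor.hom_ext fun g x => ?_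
    refine DFunLike.congr_fun
      (f := ((canM (FirmPart.toEnd j) M).comp Φ).comp (BalTensor.tmul _ _ g))
      (g := (canM (j.comp i) M).comp (BalTensor.tmul _ _ g)) (hfirm.hom_ext fun r y => ?_) x
    change TensorOver.rT C (g ∘ₗ actMapLin j)
        (FirmPart.coactHom j (σ ((j (i r) : Module.End Aᵐᵒᵖ X) y))) =
      TensorOver.rT C g (coact A C X ((j (i r) : Module.End Aᵐᵒᵖ X) y))
    rw [hσ, FirmPart.coactHom_incl, ← TensorOver.rT_comp, LinearMap.comp_assoc,
      FirmPart.actMapLin_incl, TensorOver.rT_comp, (j (i r)).2 y]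
  have hsurj : Function.Surjective Φ := by
    -- For `x = r y`: `s ⊗ r y = s (i r ⊗ y) = s σ(r y)`. Moving `s` onto `f` produces `f ∘ lmul s`,
    -- which is `(f ∘ incl s) μ`.
    have hgen : ∀ (f : FirmPart j →ₗ[Aᵐᵒᵖ] M) (s : S) (x : X),
        BalTensor.tmul (homAct (FirmPart.toEnd j) M) (endAct (FirmPart.toEnd j)) f
          (FirmPart.incl j s x) = Φ (BalTensor.tmul _ _ (f ∘ₗ FirmPart.incl j s) x) := by
      intro f s x
      refine DFunLike.congr_fun
        (f := (BalTensor.tmul (homAct (FirmPart.toEnd j) M) (endAct (FirmPart.toEnd j)) f).comp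
          (FirmPart.incl j s).toAddMonoidHom)
        (g := Φ.comp (BalTensor.tmul _ _ (f ∘ₗ FirmPart.incl j s)))
        (hfirm.hom_ext fun r y => ?_) x
      change BalTensor.tmul _ _ f
          ((FirmPart.incl j s ∘ₗ (j (i r) : Module.End Aᵐᵒᵖ X)) y) =
        BalTensor.tmul _ _ ((f ∘ₗ FirmPart.incl j s) ∘ₗ actMapLin j)
          (σ ((j (i r) : Module.End Aᵐᵒᵖ X) y))
      rw [hσ, ← FirmPart.incl_mul, LinearMap.comp_assoc, ← FirmPart.lmul_eq]
      exact (BalTensor.tmul_balanced (α := homAct (FirmPart.toEnd j) M)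
          (β := endAct (FirmPart.toEnd j)) s f (FirmPart.incl j (i r) y)).symm
    intro z
    induction z using BalTensor.induction with
    | tmul f y =>
      induction y using BalTensor.induction with
      | tmul s x => exact ⟨_, (hgen f s x).symm⟩
      | add x y hx hy =>
        obtain ⟨a, ha⟩ := hx
        obtain ⟨b, hb⟩ := hy
        exact ⟨a + b, by rw [map_add, map_add, ha, hb]⟩
    | add x y hx hy =>
      obtain ⟨a, ha⟩ := hx
      obtain ⟨b, hb⟩ := hy
      exact ⟨a + b, by rw [map_add, ha, hb]⟩
  have hbij : Function.Bijective (canM (FirmPart.toEnd j) M ∘ Φ) := by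
    rw [← AddMonoidHom.coe_comp, hcomp]
    exact h
  -- Injectivity of `Φ` is inherited from the bijective composite, so `Φ` is bijective and can be
  -- cancelled.
  exact (Function.Bijective.of_comp_iff _ ⟨hbij.1.of_comp, hsurj⟩).1 hbij

end ChangeOfRing

theorem proposition4p1 {A : Type uA} {C : Type uC} {X : Type uX}
    {R : Type uR} {S : Type uS} [Ring A] [AddCommGroup C] [Module A C] [Module Aᵐᵒᵖ C]
    [SMulCommClass A Aᵐᵒᵖ C] [Coring A C] [AddCommGroup X] [Module Aᵐᵒᵖ X] [RightComodule A C X]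
    [NonUnitalRing R] (hR : IsFirmRing R) (jR : R →ₙ+* ComodEnd A C X)
    (hX : IsGaloisComodule jR)
    [NonUnitalRing S] (hS : IsFirmRing S) (i : R →ₙ+* S) (jS : S →ₙ+* ComodEnd A C X)
    (hij : jS.comp i = jR) :
    IsComonadicGalois.{w} (FirmPart.toEnd jS) := by
  subst hij
  exact ⟨FirmPart.isFirmModule hS jS, fun M _ _ =>
    canM_toEnd_bijective i jS hX.1.1 M (hX.canM_bijective M)⟩
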